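/- Throughout, $n\ge 0$, $\mathbb R^{n+1}$ and $\mathbb R^n$ carry the Euclidean norm, and $\mathbb B_\delta(x)$ is the closed ball of radius $\delta$ around $x$. Let $\Omega\subseteq\mathbb R^{n+1}$. *Normal cones.* For $\omega\in\Omega$, the Fréchet normal cone $\hat N_\Omega(\omega)$ is the set of all $v$ such that for every $\varepsilon>0$ there is $\delta>0$ with $\langle v,\omega'-\omega\rangle\le\varepsilon\|\omega'-\omega\|$ for all $\omega'\in\Omega\cap\mathbb B_\delta(\omega)$; the limiting normal cone $N_\Omega(\omega)$ is the set of all limits of sequences $v_k\in\hat N_\Omega(\omega_k)$ with $\omega_k\in\Omega$, $\omega_k\to\omega$; the Clarke normal cone is $N^{\mathrm C}_\Omega(\omega)=\operatorname{cl}\operatorname{conv}N_\Omega(\omega)$. All these cones are empty at points $\omega\notin\Omega$. *Regularity of sets.* $\Omega$ is *Clarke super-regular* at $\bar\omega\in\Omega$ if it is locally closed at $\bar\omega$ and for every $\varepsilon>0$ there is $\delta>0$ such that $\langle v,\omega-\hat\omega\rangle\le\varepsilon\|v\|\,\|\omega-\hat\omega\|$ for all $\hat\omega\in\mathbb B_\delta(\bar\omega)$,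 all $v\in N^{\mathrm C}_\Omega(\hat\omega)$ and all $\omega\in\Omega\cap\mathbb B_\delta(\bar\omega)$. $\Omega$ is *subsmooth* at $\bar\omega\in\Omega$ if for all $r,\varepsilon>0$ there is $\delta>0$ such that $\langle v_1-v_2,\omega_1-\omega_2\rangle\ge-\varepsilon\|\omega_1-\omega_2\|$ for all $\omega_1,\omega_2\in\Omega\cap\mathbb B_\delta(\bar\omega)$ and all $v_i\in N^{\mathrm C}_\Omega(\omega_i)$ with $\|v_i\|\le r$, $i=1,2$. *Approximate convexity.* $f:\mathbb R^n\to\mathbb R$ is *approximately convex* at $\bar x$ if for every $\varepsilon>0$ there is $\delta>0$ such that $f(tx+(1-t)y)\le tf(x)+(1-t)f(y)+\varepsilon t(1-t)\|x-y\|$ for all $x,y\in\mathbb B_\delta(\bar x)$ and $t\in(0,1)$. *Lipschitz representations.* A *locally Lipschitz representation* of $\Omega$ at $\bar\omega$ is a function $f:\mathbb R^n\to\mathbb R$ together with linear coordinates on $\mathbb R^{n+1}$, i.e. a linear isomorphism $L:\mathbb R^{n+1}\to\mathbb R^n\times\mathbb R$, $L\omega=(\pi(\omega),\tau(\omega))$,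 such that $f$ is Lipschitz on a neighbourhood of $\pi(\bar\omega)$ and, for some neighbourhood $U$ of $\bar\omega$, $\Omega\cap U=\{\omega\in U: f(\pi(\omega))\le\tau(\omega)\}$. $\Omega$ is *epi-Lipschitz* at $\bar\omega\in\Omega$ if it has a locally Lipschitz representation at $\bar\omega$. **Proposition.** Let $\Omega\subseteq\mathbb R^{n+1}$ be epi-Lipschitz at a boundary point $\bar\omega\in\Omega$. Then the following are equivalent: 1. $\Omega$ is Clarke super-regular at $\bar\omega$; 2. $\Omega$ is subsmooth at $\bar\omega$; 3. every locally Lipschitz representation of $\Omega$ at $\bar\omega$ is approximately convex at $\pi(\bar\omega)$; 4. some locally Lipschitz representation of $\Omega$ at $\bar\omega$ is approximately convex at $\pi(\bar\omega)$. -/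

import Mathlib

open Filter Topology Metric

/-- The Fréchet normal cone of `Ω` at `ω` (empty if `ω ∉ Ω`). -/
def frechetNormalCone {E : Type*} [NormedAddCommGroup E] [InnerProductSpace ℝ E]
    (Ω : Set E) (ω : E) : Set E :=
  {v | ω ∈ Ω ∧ ∀ ε : ℝ, 0 < ε → ∃ δ : ℝ, 0 < δ ∧
    ∀ ω' ∈ Ω ∩ closedBall ω δ, inner ℝ v (ω' - ω) ≤ ε * ‖ω' - ω‖}

/-- The limiting normal cone of `Ω` at `ω` (empty if `ω ∉ Ω`): the Painlevé–Kuratowski outer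
limit of the Fréchet normal cones at points tending to `ω`. -/
def limitingNormalCone {E : Type*} [NormedAddCommGroup E] [InnerProductSpace ℝ E]
    (Ω : Set E) (ω : E) : Set E :=
  {v | ω ∈ Ω ∧ ∃ x w : ℕ → E, Tendsto x atTop (𝓝 ω) ∧ Tendsto w atTop (𝓝 v) ∧
    ∀ k, w k ∈ frechetNormalCone Ω (x k)}

/-- The Clarke normal cone of `Ω` at `ω` (empty if `ω ∉ Ω`): the closed convex hull of the
limiting normal cone. -/
def clarkeNormalCone {E : Type*} [NormedAddCommGroup E] [InnerProductSpace ℝ E]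
    (Ω : Set E) (ω : E) : Set E :=
  closure (convexHull ℝ (limitingNormalCone Ω ω))

/-- The `r`-truncated Clarke normal cone. -/
def truncatedClarkeNormalCone {E : Type*} [NormedAddCommGroup E] [InnerProductSpace ℝ E]
    (Ω : Set E) (r : ℝ) (ω : E) : Set E :=
  clarkeNormalCone Ω ω ∩ closedBall 0 r

/-- `Ω` is locally closed at the point `ω`: its intersection with some closed ball
around `ω` is closed. -/
def LocallyClosedAt {E : Type*} [NormedAddCommGroup E] (Ω : Set E) (ω : E) : Prop :=
  ∃ ρ : ℝ, 0 < ρ ∧ IsClosed (Ω ∩ closedBall ω ρ)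

/-- Clarke super-regularity of `Ω` at `ω₀`. -/
def ClarkeSuperRegularAt {E : Type*} [NormedAddCommGroup E] [InnerProductSpace ℝ E]
    (Ω : Set E) (ω₀ : E) : Prop :=
  ω₀ ∈ Ω ∧ LocallyClosedAt Ω ω₀ ∧ ∀ ε : ℝ, 0 < ε → ∃ δ : ℝ, 0 < δ ∧
    ∀ ω' ∈ closedBall ω₀ δ, ∀ v ∈ clarkeNormalCone Ω ω', ∀ ω ∈ Ω ∩ closedBall ω₀ δ,
      inner ℝ v (ω - ω') ≤ ε * ‖v‖ * ‖ω - ω'‖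

/-- Subsmoothness of `Ω` at `ω₀`. -/
def SubsmoothAt {E : Type*} [NormedAddCommGroup E] [InnerProductSpace ℝ E]
    (Ω : Set E) (ω₀ : E) : Prop :=
  ω₀ ∈ Ω ∧ ∀ r : ℝ, 0 < r → ∀ ε : ℝ, 0 < ε → ∃ δ : ℝ, 0 < δ ∧
    ∀ ω₁ ∈ closedBall ω₀ δ ∩ Ω, ∀ ω₂ ∈ closedBall ω₀ δ ∩ Ω,
      ∀ v₁ ∈ truncatedClarkeNormalCone Ω r ω₁, ∀ v₂ ∈ truncatedClarkeNormalCone Ω r ω₂,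
        inner ℝ (v₁ - v₂) (ω₁ - ω₂) ≥ -ε * ‖ω₁ - ω₂‖

/-- Approximate convexity of a real function at `x₀`. -/
def ApproxConvexAt {E : Type*} [NormedAddCommGroup E] [NormedSpace ℝ E]
    (f : E → ℝ) (x₀ : E) : Prop :=
  ∀ ε : ℝ, 0 < ε → ∃ δ : ℝ, 0 < δ ∧
    ∀ x ∈ closedBall x₀ δ, ∀ y ∈ closedBall x₀ δ, ∀ t ∈ Set.Ioo (0 : ℝ) 1,
      f (t • x + (1 - t) • y) ≤
        t * f x + (1 - t) * f y + ε * t * (1 - t) * ‖x - y‖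

/-- In the linear coordinates `L ω = (x, t) ∈ ℝⁿ × ℝ`, the function `f` is a locally Lipschitz
representation of `Ω ⊆ ℝⁿ⁺¹` at `ω₀`: it is Lipschitz on a neighbourhood of the
projection `(L ω₀).1`, and `Ω` agrees near `ω₀` with the epigraph of `f`. -/
def IsLipschitzRepresentation {n : ℕ} (Ω : Set (EuclideanSpace ℝ (Fin (n + 1))))
    (ω₀ : EuclideanSpace ℝ (Fin (n + 1)))
    (L : EuclideanSpace ℝ (Fin (n + 1)) ≃L[ℝ] EuclideanSpace ℝ (Fin n) × ℝ)
    (f : EuclideanSpace ℝ (Fin n) → ℝ) : Prop :=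
  (∃ K, ∃ V ∈ 𝓝 (L ω₀).1, LipschitzOnWith K f V) ∧
    ∃ U ∈ 𝓝 ω₀, ∀ ω ∈ U, ω ∈ Ω ↔ f (L ω).1 ≤ (L ω).2

/-- `Ω ⊆ ℝⁿ⁺¹` is epi-Lipschitz at `ω₀ ∈ Ω`: in suitable linear coordinates it is, near `ω₀`,
the epigraph of a Lipschitz function. -/
def EpiLipschitzAt {n : ℕ} (Ω : Set (EuclideanSpace ℝ (Fin (n + 1))))
    (ω₀ : EuclideanSpace ℝ (Fin (n + 1))) : Prop :=
  ω₀ ∈ Ω ∧ ∃ L f, IsLipschitzRepresentation Ω ω₀ L f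

/-!
Near `ω₀` the set `Ω` is, in the coordinates `L`, the epigraph of a Lipschitz function `f`. Write
`e = L⁻¹ (0, 1)` for the vertical direction.

Super-regularity and subsmoothness are equivalent for every locally closed set: the Clarke normal
cone is a cone that contains `0`, so subsmoothness tested on the pair `(v, 0)` with `v` a unit
normal is the inequality of super-regularity, and adding up two such inequalities gives
subsmoothness back.

If `f` is approximately convex and `p, q ∈ Ω` are near `ω₀`, then the points
`p + θ (q - p + ε ‖π q - π p‖ e)` lie in `Ω` for small `θ > 0`, so that
`⟪v, q - p⟫ ≤ -ε ‖π q - π p‖ ⟪v, e⟫` for every Fréchet normal `v` at `p`. This inequality is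
linear in `v` and continuous in `(p, v)`; it therefore passes to limiting normals and to the closed
convex hull, which yields super-regularity (`ApproxConvexAt.clarkeSuperRegularAt`).

Conversely, where `f` is differentiable the functional `(f' z, -1)` is a Fréchet normal to the
epigraph, with norm bounded in terms of the Lipschitz constant
(`exists_mem_frechetNormalCone_of_hasFDerivAt`). Super-regularity bounds `f` from below by its
tangent at `z`, up to `ε ‖x - z‖`. Averaging two such bounds at a convex combination `z` of `x` and
`y` gives the inequality of approximate convexity for `z`. By Rademacher's theorem these `z` are
dense, and the general case follows by translating the triple `(x, y, z)` and continuity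
(`ClarkeSuperRegularAt.approxConvexAt`).
-/

/-! ### Normal cones -/

section NormalCones

variable {E : Type*} [NormedAddCommGroup E] [InnerProductSpace ℝ E] {Ω : Set E} {ω v : E}

theorem frechetNormalCone_subset_limitingNormalCone :
    frechetNormalCone Ω ω ⊆ limitingNormalCone Ω ω := fun v hv =>
  ⟨hv.1, fun _ => ω, fun _ => v, tendsto_const_nhds, tendsto_const_nhds, fun _ => hv⟩

theorem limitingNormalCone_subset_clarkeNormalCone :
    limitingNormalCone Ω ω ⊆ clarkeNormalCone Ω ω :=
  (subset_convexHull ℝ _).trans subset_closure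

theorem mem_of_mem_clarkeNormalCone (hv : v ∈ clarkeNormalCone Ω ω) : ω ∈ Ω := by
  have h : (limitingNormalCone Ω ω).Nonempty := by
    have h1 : (closure (convexHull ℝ (limitingNormalCone Ω ω))).Nonempty := ⟨v, hv⟩
    rwa [closure_nonempty_iff, convexHull_nonempty_iff] at h1
  exact h.some_mem.1

theorem zero_mem_clarkeNormalCone (hω : ω ∈ Ω) : (0 : E) ∈ clarkeNormalCone Ω ω := by
  refine limitingNormalCone_subset_clarkeNormalCone
    (frechetNormalCone_subset_limitingNormalCone ⟨hω, fun ε hε => ⟨1, one_pos, fun ω' _ => ?_⟩⟩)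
  rw [inner_zero_left]
  positivity

theorem smul_mem_frechetNormalCone {c : ℝ} (hc : 0 < c) (hv : v ∈ frechetNormalCone Ω ω) :
    c • v ∈ frechetNormalCone Ω ω := by
  refine ⟨hv.1, fun ε hε => ?_⟩
  obtain ⟨δ, hδ, h⟩ := hv.2 (ε / c) (by positivity)
  refine ⟨δ, hδ, fun ω' hω' => ?_⟩
  rw [real_inner_smul_left]
  calc c * inner ℝ v (ω' - ω) ≤ c * (ε / c * ‖ω' - ω‖) := by gcongr; exact h ω' hω'
    _ = ε * ‖ω' - ω‖ := by field_simp

theorem smul_mem_limitingNormalCone {c : ℝ} (hc : 0 < c) (hv : v ∈ limitingNormalCone Ω ω) :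
    c • v ∈ limitingNormalCone Ω ω := by
  obtain ⟨hω, x, w, hx, hw, h⟩ := hv
  exact ⟨hω, x, fun k => c • w k, hx, hw.const_smul c,
    fun k => smul_mem_frechetNormalCone hc (h k)⟩

theorem smul_mem_clarkeNormalCone {c : ℝ} (hc : 0 < c) (hv : v ∈ clarkeNormalCone Ω ω) :
    c • v ∈ clarkeNormalCone Ω ω := by
  refine map_mem_closure (f := fun u : E => c • u) (continuous_const_smul c) hv fun u hu => ?_
  have h : c • u ∈ (LinearMap.lsmul ℝ E c) '' convexHull ℝ (limitingNormalCone Ω ω) :=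
    ⟨u, hu, rfl⟩
  rw [LinearMap.image_convexHull] at h
  refine convexHull_mono ?_ h
  rintro _ ⟨w, hw, rfl⟩
  exact smul_mem_limitingNormalCone hc hw

/-- A closed convex set that contains all limiting normals contains all Clarke normals. -/
theorem clarkeNormalCone_subset {S : Set E} (hS : Convex ℝ S) (hc : IsClosed S)
    (h : limitingNormalCone Ω ω ⊆ S) : clarkeNormalCone Ω ω ⊆ S :=
  closure_minimal (convexHull_min h hS) hc

/-- Fréchet normals are polar to the directions along which a short segment stays in the set. -/
theorem inner_nonpos_of_mem_frechetNormalCone {d : E} (hv : v ∈ frechetNormalCone Ω ω)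
    (hd : ∀ᶠ θ : ℝ in 𝓝[>] 0, ω + θ • d ∈ Ω) : inner ℝ v d ≤ 0 := by
  refine le_of_forall_pos_le_add fun η hη => ?_
  obtain ⟨δ, hδ, h⟩ := hv.2 (η / (‖d‖ + 1)) (by positivity)
  have ht : Tendsto (fun θ : ℝ => ω + θ • d) (𝓝[>] 0) (𝓝 ω) := by
    have : Continuous fun θ : ℝ => ω + θ • d := by fun_prop
    simpa using (this.tendsto 0).mono_left nhdsWithin_le_nhds
  obtain ⟨θ, ⟨hθ, hθδ⟩, hθ0⟩ :=
    ((hd.and (ht (closedBall_mem_nhds ω hδ))).and self_mem_nhdsWithin).exists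
  have hθ0 : 0 < θ := hθ0
  have h1 := h _ ⟨hθ, hθδ⟩
  rw [add_sub_cancel_left, real_inner_smul_right, norm_smul, Real.norm_of_nonneg hθ0.le,
    mul_left_comm] at h1
  have h2 : inner ℝ v d ≤ η / (‖d‖ + 1) * ‖d‖ := le_of_mul_le_mul_left h1 hθ0
  have h3 : η / (‖d‖ + 1) * ‖d‖ ≤ η := by
    rw [div_mul_eq_mul_div, div_le_iff₀ (by positivity)]
    nlinarith
  linarith

end NormalCones

/-! ### Super-regularity and subsmoothness -/

section Regularity

variable {E : Type*} [NormedAddCommGroup E] [InnerProductSpace ℝ E] {Ω : Set E} {ω₀ : E}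

theorem ClarkeSuperRegularAt.subsmoothAt (h : ClarkeSuperRegularAt Ω ω₀) : SubsmoothAt Ω ω₀ := by
  refine ⟨h.1, fun r hr ε hε => ?_⟩
  obtain ⟨δ, hδ, H⟩ := h.2.2 (ε / (2 * r)) (by positivity)
  refine ⟨δ, hδ, fun ω₁ h₁ ω₂ h₂ v₁ hv₁ v₂ hv₂ => ?_⟩
  have key : ∀ v a : E, v ∈ closedBall (0 : E) r →
      ε / (2 * r) * ‖v‖ * ‖a‖ ≤ ε / 2 * ‖a‖ := fun v a hv => by
    have hv : ‖v‖ ≤ r := by simpa using hv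
    calc ε / (2 * r) * ‖v‖ * ‖a‖ ≤ ε / (2 * r) * r * ‖a‖ := by gcongr
      _ = ε / 2 * ‖a‖ := by field_simp
  have e₁ := (H ω₁ h₁.1 v₁ hv₁.1 ω₂ h₂.symm).trans (key _ _ hv₁.2)
  have e₂ := (H ω₂ h₂.1 v₂ hv₂.1 ω₁ h₁.symm).trans (key _ _ hv₂.2)
  rw [← neg_sub ω₁ ω₂, inner_neg_right, norm_neg] at e₁
  rw [inner_sub_left]
  linarith

theorem SubsmoothAt.clarkeSuperRegularAt (h : SubsmoothAt Ω ω₀) (hc : LocallyClosedAt Ω ω₀) :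
    ClarkeSuperRegularAt Ω ω₀ := by
  refine ⟨h.1, hc, fun ε hε => ?_⟩
  obtain ⟨δ, hδ, H⟩ := h.2 1 one_pos ε hε
  refine ⟨δ, hδ, fun ω' hω' v hv ω hω => ?_⟩
  rcases eq_or_ne v 0 with rfl | hv0
  · simp
  have hn : 0 < ‖v‖ := norm_pos_iff.2 hv0
  have hu : ‖v‖⁻¹ • v ∈ truncatedClarkeNormalCone Ω 1 ω' :=
    ⟨smul_mem_clarkeNormalCone (inv_pos.2 hn) hv, by
      simp [norm_smul, inv_mul_cancel₀ hn.ne']⟩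
  have h0 : (0 : E) ∈ truncatedClarkeNormalCone Ω 1 ω :=
    ⟨zero_mem_clarkeNormalCone hω.1, by simp⟩
  have h1 := H ω' ⟨hω', mem_of_mem_clarkeNormalCone hv⟩ ω hω.symm _ hu _ h0
  rw [sub_zero, real_inner_smul_left, ← neg_sub ω ω', inner_neg_right, norm_neg] at h1
  have h2 : ‖v‖⁻¹ * inner ℝ v (ω - ω') ≤ ε * ‖ω - ω'‖ := by linarith
  rw [inv_mul_le_iff₀ hn] at h2
  linarith

end Regularity

/-! ### Approximate convexity implies super-regularity -/

section Epigraph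

variable {E X : Type*} [NormedAddCommGroup E] [InnerProductSpace ℝ E]
  [NormedAddCommGroup X] [NormedSpace ℝ X] {Ω : Set E} {ω₀ : E} {L : E ≃L[ℝ] X × ℝ} {f : X → ℝ}

theorem locallyClosedAt_of_epigraph {V : Set X} (hV : V ∈ 𝓝 (L ω₀).1) (hf : ContinuousOn f V)
    (hΩ : ∀ᶠ ω in 𝓝 ω₀, ω ∈ Ω ↔ f (L ω).1 ≤ (L ω).2) : LocallyClosedAt Ω ω₀ := by
  have hπ : Continuous fun ω => (L ω).1 := by fun_prop
  have hτ : Continuous fun ω => (L ω).2 := by fun_prop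
  obtain ⟨ρ, hρ, H⟩ := nhds_basis_closedBall.eventually_iff.1
    (hΩ.and (hπ.continuousAt.eventually_mem hV))
  refine ⟨ρ, hρ, ?_⟩
  have : Ω ∩ closedBall ω₀ ρ = {ω ∈ closedBall ω₀ ρ | f (L ω).1 ≤ (L ω).2} := by
    ext ω
    exact ⟨fun h => ⟨h.2, (H h.2).1.1 h.1⟩, fun h => ⟨(H h.1).1.2 h.2, h.1⟩⟩
  rw [this]
  exact isClosed_closedBall.isClosed_le (hf.comp hπ.continuousOn fun ω hω => (H hω).2)
    hτ.continuousOn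

/-- A Fréchet normal `v` at a point `p` of an approximately convex epigraph satisfies an inequality
that is linear in `v` and depends continuously on `p`. -/
theorem inner_sub_le_of_mem_frechetNormalCone {p q v : E} {ε : ℝ}
    (hε : 0 ≤ ε) (hv : v ∈ frechetNormalCone Ω p)
    (hp : ∀ᶠ ω in 𝓝 p, ω ∈ Ω ↔ f (L ω).1 ≤ (L ω).2) (hq : f (L q).1 ≤ (L q).2)
    (hf : ∀ t ∈ Set.Ioo (0 : ℝ) 1, f (t • (L q).1 + (1 - t) • (L p).1) ≤
      t * f (L q).1 + (1 - t) * f (L p).1 + ε * t * (1 - t) * ‖(L q).1 - (L p).1‖) :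
    inner ℝ v (q - p) ≤ -(ε * ‖(L q).1 - (L p).1‖ * inner ℝ v (L.symm (0, 1))) := by
  set m := ε * ‖(L q).1 - (L p).1‖ with hm
  have hm0 : 0 ≤ m := by positivity
  suffices h : inner ℝ v (q - p + m • L.symm (0, 1)) ≤ 0 by
    rw [inner_add_right, real_inner_smul_right] at h
    linarith
  refine inner_nonpos_of_mem_frechetNormalCone hv ?_
  have ht : Tendsto (fun θ : ℝ => p + θ • (q - p + m • L.symm (0, 1))) (𝓝[>] 0) (𝓝 p) := by
    have : Continuous fun θ : ℝ => p + θ • (q - p + m • L.symm (0, 1)) := by fun_prop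
    simpa using (this.tendsto 0).mono_left nhdsWithin_le_nhds
  filter_upwards [ht.eventually hp, Ioo_mem_nhdsGT (zero_lt_one (α := ℝ))] with θ hθ hθ1
  rw [hθ]
  have hp' := hp.self_of_nhds.1 hv.1
  have e : L (p + θ • (q - p + m • L.symm (0, 1))) =
      (θ • (L q).1 + (1 - θ) • (L p).1, θ * (L q).2 + (1 - θ) * (L p).2 + θ * m) := by
    ext
    · simp only [map_add, map_smul, map_sub, ContinuousLinearEquiv.apply_symm_apply, Prod.fst_add,
        Prod.smul_fst, Prod.fst_sub]
      module
    · simp only [map_add, map_smul, map_sub, ContinuousLinearEquiv.apply_symm_apply, Prod.snd_add,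
        Prod.smul_snd, Prod.snd_sub, smul_eq_mul]
      ring
  rw [e]
  have h0 := hθ1.1
  have h1 : 0 ≤ 1 - θ := by linarith [hθ1.2]
  have a1 : θ * f (L q).1 ≤ θ * (L q).2 := by gcongr
  have a2 : (1 - θ) * f (L p).1 ≤ (1 - θ) * (L p).2 := by gcongr
  have a3 : ε * θ * (1 - θ) * ‖(L q).1 - (L p).1‖ ≤ θ * m := by
    have : 0 ≤ θ * θ * m := by positivity
    calc _ = θ * m - θ * θ * m := by rw [hm]; ring
      _ ≤ _ := by linarith
  exact (hf θ hθ1).trans (by linarith)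

theorem ApproxConvexAt.clarkeSuperRegularAt (hf : ApproxConvexAt f (L ω₀).1) (hω₀ : ω₀ ∈ Ω)
    (hcl : LocallyClosedAt Ω ω₀) (hΩ : ∀ᶠ ω in 𝓝 ω₀, ω ∈ Ω ↔ f (L ω).1 ≤ (L ω).2) :
    ClarkeSuperRegularAt Ω ω₀ := by
  refine ⟨hω₀, hcl, fun ε hε => ?_⟩
  set e := L.symm (0, 1) with he
  set C : ℝ := ‖(L : E →L[ℝ] X × ℝ)‖ with hC
  set η := ε / (C * ‖e‖ + 1) with hη
  have hη0 : 0 < η := by positivity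
  obtain ⟨δ₁, hδ₁, H⟩ := hf η hη0
  have hπ : Continuous fun ω => (L ω).1 := by fun_prop
  obtain ⟨δ, hδ, hball⟩ := nhds_basis_ball.eventually_iff.1
    (hΩ.eventually_nhds.and (hπ.continuousAt.eventually_mem (closedBall_mem_nhds _ hδ₁)))
  -- The inequality is needed at points near `p` as well, hence on an open ball.
  have hfre : ∀ p ∈ ball ω₀ δ, ∀ v ∈ frechetNormalCone Ω p, ∀ q ∈ Ω ∩ ball ω₀ δ,
      inner ℝ v (q - p) ≤ -(η * ‖(L q).1 - (L p).1‖ * inner ℝ v e) := fun p hp v hv q hq =>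
    inner_sub_le_of_mem_frechetNormalCone hη0.le hv (hball hp).1
      ((hball hq.2).1.self_of_nhds.1 hq.1)
      fun t ht => H _ (hball hq.2).2 _ (hball hp).2 t ht
  have hsub : closedBall ω₀ (δ / 2) ⊆ ball ω₀ δ := closedBall_subset_ball (by linarith)
  refine ⟨δ / 2, by positivity, fun p hp v hv q hq => ?_⟩
  have hcla : clarkeNormalCone Ω p ⊆
      {u | inner ℝ u (q - p) ≤ -(η * ‖(L q).1 - (L p).1‖ * inner ℝ u e)} := by
    refine clarkeNormalCone_subset ?_ (isClosed_le (by fun_prop) (by fun_prop)) ?_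
    · intro a ha b hb s t hs ht hst
      simp only [Set.mem_ofPred_eq, inner_add_left, real_inner_smul_left] at ha hb ⊢
      nlinarith [mul_le_mul_of_nonneg_left ha hs, mul_le_mul_of_nonneg_left hb ht]
    · rintro u ⟨-, x, w, hx, hw, hN⟩
      refine le_of_tendsto_of_tendsto (hw.inner (tendsto_const_nhds.sub hx))
        (((tendsto_const_nhds.mul ((tendsto_const_nhds.sub
          ((hπ.tendsto p).comp hx)).norm)).mul (hw.inner tendsto_const_nhds)).neg) ?_
      filter_upwards [hx (isOpen_ball.mem_nhds (hsub hp))] with k hk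
      exact hfre _ hk _ (hN k) q ⟨hq.1, hsub hq.2⟩
  have h1 : inner ℝ v (q - p) ≤ -(η * ‖(L q).1 - (L p).1‖ * inner ℝ v e) := hcla hv
  have h2 : ‖(L q).1 - (L p).1‖ ≤ C * ‖q - p‖ := by
    rw [← Prod.fst_sub, ← map_sub]
    exact (norm_fst_le _).trans ((L : E →L[ℝ] X × ℝ).le_opNorm (q - p))
  have h3 : -inner ℝ v e ≤ ‖v‖ * ‖e‖ := by
    rw [← inner_neg_right, ← norm_neg e]
    exact real_inner_le_norm _ _
  calc inner ℝ v (q - p) ≤ η * ‖(L q).1 - (L p).1‖ * -inner ℝ v e := by linarith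
    _ ≤ η * ‖(L q).1 - (L p).1‖ * (‖v‖ * ‖e‖) := by gcongr
    _ ≤ η * (C * ‖q - p‖) * (‖v‖ * ‖e‖) := by gcongr
    _ = η * (C * ‖e‖) * (‖v‖ * ‖q - p‖) := by ring
    _ ≤ ε * (‖v‖ * ‖q - p‖) := by
      gcongr
      rw [hη, div_mul_eq_mul_div, div_le_iff₀ (by positivity)]
      nlinarith
    _ = ε * ‖v‖ * ‖q - p‖ := by ring

/-! ### Super-regularity implies approximate convexity -/

theorem apply_fst_eq_snd_of_mem_frontier (hfr : ω₀ ∈ frontier Ω) (hω₀ : ω₀ ∈ Ω)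
    (hf : ContinuousAt f (L ω₀).1) (hΩ : ∀ᶠ ω in 𝓝 ω₀, ω ∈ Ω ↔ f (L ω).1 ≤ (L ω).2) :
    f (L ω₀).1 = (L ω₀).2 := by
  refine (hΩ.self_of_nhds.1 hω₀).antisymm (le_of_not_gt fun hlt => hfr.2 ?_)
  have h1 : ContinuousAt (fun ω => f (L ω).1) ω₀ :=
    ContinuousAt.comp (f := fun ω => (L ω).1) hf (by fun_prop)
  have h2 : ContinuousAt (fun ω => (L ω).2) ω₀ := by fun_prop
  rw [mem_interior_iff_mem_nhds]
  filter_upwards [hΩ, h1.eventually_lt h2 hlt] with ω ha hb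
  exact ha.2 hb.le

/-- Where `f` is differentiable, its tangent functional `(f', -1)` is represented by a Fréchet
normal to the epigraph. -/
theorem exists_mem_frechetNormalCone_of_hasFDerivAt [CompleteSpace E] {z : X} {D : X →L[ℝ] ℝ}
    (hD : HasFDerivAt f D z)
    (hΩ : ∀ᶠ ω in 𝓝 (L.symm (z, f z)), ω ∈ Ω ↔ f (L ω).1 ≤ (L ω).2) :
    ∃ v ∈ frechetNormalCone Ω (L.symm (z, f z)), ‖v‖ ≤ (‖D‖ + 1) * ‖(L : E →L[ℝ] X × ℝ)‖ ∧
      ∀ w, inner ℝ v w = D (L w).1 - (L w).2 := by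
  set A : E →L[ℝ] ℝ := (D.comp (ContinuousLinearMap.fst ℝ X ℝ) -
    ContinuousLinearMap.snd ℝ X ℝ).comp (L : E →L[ℝ] X × ℝ) with hA
  set v := (InnerProductSpace.toDual ℝ E).symm A with hv
  have hvw : ∀ w, inner ℝ v w = D (L w).1 - (L w).2 := fun w => by
    rw [hv, InnerProductSpace.toDual_symm_apply]
    simp [hA]
  refine ⟨v, ⟨by simpa using hΩ.self_of_nhds, fun ε hε => ?_⟩, ?_, hvw⟩
  · set c := ε / (‖(L : E →L[ℝ] X × ℝ)‖ + 1) with hc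
    have hc0 : 0 < c := by positivity
    have hlin : ∀ᶠ x in 𝓝 z, ‖f x - f z - D (x - z)‖ ≤ c * ‖x - z‖ := hD.isLittleO.def hc0
    have hπ : Tendsto (fun ω => (L ω).1) (𝓝 (L.symm (z, f z))) (𝓝 z) := by
      have : Continuous fun ω => (L ω).1 := by fun_prop
      simpa using this.tendsto (L.symm (z, f z))
    obtain ⟨δ, hδ, H⟩ := nhds_basis_closedBall.eventually_iff.1 (hΩ.and (hπ.eventually hlin))
    refine ⟨δ, hδ, fun ω hω => ?_⟩
    obtain ⟨h1, h2⟩ := H hω.2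
    have h3 := h1.1 hω.1
    have h4 := neg_le_of_abs_le (Real.norm_eq_abs _ ▸ h2)
    have h5 : ‖(L ω).1 - z‖ ≤ ‖(L : E →L[ℝ] X × ℝ)‖ * ‖ω - L.symm (z, f z)‖ := by
      refine le_trans ?_ ((L : E →L[ℝ] X × ℝ).le_opNorm _)
      refine le_trans (le_of_eq ?_) (norm_fst_le _)
      simp
    rw [hvw]
    simp only [map_sub, ContinuousLinearEquiv.apply_symm_apply, Prod.fst_sub, Prod.snd_sub] at h4 ⊢
    have h6 : c * ‖(L ω).1 - z‖ ≤ ε * ‖ω - L.symm (z, f z)‖ :=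
      calc c * ‖(L ω).1 - z‖ ≤ c * (‖(L : E →L[ℝ] X × ℝ)‖ * ‖ω - L.symm (z, f z)‖) := by gcongr
        _ = c * ‖(L : E →L[ℝ] X × ℝ)‖ * ‖ω - L.symm (z, f z)‖ := by ring
        _ ≤ ε * ‖ω - L.symm (z, f z)‖ := by
          gcongr
          rw [hc, div_mul_eq_mul_div, div_le_iff₀ (by positivity)]
          nlinarith
    linarith
  · rw [hv, LinearIsometryEquiv.norm_map]
    refine (ContinuousLinearMap.opNorm_comp_le _ _).trans ?_
    gcongr
    refine (norm_sub_le _ _).trans ?_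
    gcongr
    · exact (ContinuousLinearMap.opNorm_comp_le _ _).trans
        (mul_le_of_le_one_right (norm_nonneg _) (ContinuousLinearMap.norm_fst_le ..))
    · exact ContinuousLinearMap.norm_snd_le ..

/-- Super-regularity of the epigraph bounds a Lipschitz function from below by its tangents,
uniformly near the base point. -/
theorem ClarkeSuperRegularAt.exists_fderiv_sub_le [CompleteSpace E] {K : NNReal} {V : Set X}
    (h : ClarkeSuperRegularAt Ω ω₀) (hV : V ∈ 𝓝 (L ω₀).1) (hf : LipschitzOnWith K f V)
    (h0 : f (L ω₀).1 = (L ω₀).2) (hΩ : ∀ᶠ ω in 𝓝 ω₀, ω ∈ Ω ↔ f (L ω).1 ≤ (L ω).2)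
    {ε : ℝ} (hε : 0 < ε) :
    ∀ᶠ ρ in 𝓝[>] (0 : ℝ), ∀ z ∈ ball (L ω₀).1 ρ, DifferentiableAt ℝ f z →
      ∀ x ∈ ball (L ω₀).1 ρ, fderiv ℝ f z (x - z) - (f x - f z) ≤ ε * ‖x - z‖ := by
  set C : ℝ := ‖(L : E →L[ℝ] X × ℝ)‖ with hC
  set C' : ℝ := ‖(L.symm : X × ℝ →L[ℝ] E)‖ with hC'
  set M : ℝ := (K + 1) * C * (C' * (K + 1)) with hM
  obtain ⟨δ, hδ, H⟩ := h.2.2 (ε / (M + 1)) (by positivity)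
  have hcont : ContinuousAt f (L ω₀).1 := hf.continuousOn.continuousAt hV
  have hg : Tendsto (fun x => L.symm (x, f x)) (𝓝 (L ω₀).1) (𝓝 ω₀) := by
    have : ContinuousAt (fun x => L.symm (x, f x)) (L ω₀).1 :=
      L.symm.continuous.continuousAt.comp (continuousAt_id.prodMk hcont)
    simpa [ContinuousAt, h0] using this
  obtain ⟨ρ₀, hρ₀, hball⟩ := nhds_basis_ball.eventually_iff.1
    ((hg.eventually hΩ.eventually_nhds).and ((hg.eventually (closedBall_mem_nhds ω₀ hδ)).and
      (eventually_mem_nhds_iff.2 hV)))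
  filter_upwards [Ioo_mem_nhdsGT hρ₀] with ρ hρ z hz hdiff x hx
  obtain ⟨hz1, hz2, hz3⟩ := hball (ball_subset_ball hρ.2.le hz)
  obtain ⟨hx1, hx2, hx3⟩ := hball (ball_subset_ball hρ.2.le hx)
  obtain ⟨v, hv, hvn, hvw⟩ :=
    exists_mem_frechetNormalCone_of_hasFDerivAt hdiff.hasFDerivAt hz1
  have hD : ‖fderiv ℝ f z‖ ≤ K := norm_fderiv_le_of_lipschitzOn ℝ hz3 hf
  have hxΩ : L.symm (x, f x) ∈ Ω := by simpa using hx1.self_of_nhds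
  have h1 := H _ hz2 v (limitingNormalCone_subset_clarkeNormalCone
    (frechetNormalCone_subset_limitingNormalCone hv)) _ ⟨hxΩ, hx2⟩
  rw [hvw, ← map_sub, ContinuousLinearEquiv.apply_symm_apply] at h1
  simp only [Prod.mk_sub_mk] at h1
  have h2 : ‖L.symm (x - z, f x - f z)‖ ≤ C' * ((K + 1) * ‖x - z‖) := by
    refine ((L.symm : X × ℝ →L[ℝ] E).le_opNorm _).trans ?_
    gcongr
    rw [Prod.norm_def]
    have h3 := hf.norm_sub_le (mem_of_mem_nhds hx3) (mem_of_mem_nhds hz3)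
    have h4 : 0 ≤ (K : ℝ) * ‖x - z‖ := by positivity
    have h5 := norm_nonneg (x - z)
    exact max_le (by linarith) (by linarith)
  have h6 : ‖v‖ ≤ (K + 1) * C := hvn.trans (by gcongr)
  refine h1.trans ?_
  calc ε / (M + 1) * ‖v‖ * ‖L.symm (x - z, f x - f z)‖
      ≤ ε / (M + 1) * ((K + 1) * C) * (C' * ((K + 1) * ‖x - z‖)) := by gcongr
    _ = ε / (M + 1) * M * ‖x - z‖ := by rw [hM]; ring
    _ ≤ ε * ‖x - z‖ := by
      gcongr
      have : 0 ≤ M := by positivity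
      rw [div_mul_eq_mul_div, div_le_iff₀ (by positivity)]
      nlinarith

open MeasureTheory in
/-- The density form of Rademacher's theorem. -/
theorem LipschitzOnWith.subset_closure_differentiableAt [FiniteDimensional ℝ X] {K : NNReal}
    {V : Set X} (hf : LipschitzOnWith K f V) (hV : IsOpen V) :
    V ⊆ closure {z | DifferentiableAt ℝ f z} := by
  let _ : MeasurableSpace X := borel X
  have _ : BorelSpace X := ⟨rfl⟩
  have hd : Dense {z | z ∈ V → DifferentiableWithinAt ℝ f V z} :=
    Measure.dense_of_ae (hf.ae_differentiableWithinAt_of_mem (μ := Measure.addHaar))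
  refine (hd.open_subset_closure_inter hV).trans (closure_mono fun z hz => ?_)
  exact (hz.2 hz.1).differentiableAt (hV.mem_nhds hz.1)

/-- Lower bounds by tangents on a dense set of points of differentiability imply the inequality of
approximate convexity: average the bounds at a convex combination, then use continuity. -/
theorem le_of_fderiv_sub_le {x₀ : X} {ρ ε : ℝ} (hf : ContinuousOn f (ball x₀ ρ))
    (hdense : ball x₀ ρ ⊆ closure {z | DifferentiableAt ℝ f z})
    (H : ∀ z ∈ ball x₀ ρ, DifferentiableAt ℝ f z → ∀ x ∈ ball x₀ ρ,
      fderiv ℝ f z (x - z) - (f x - f z) ≤ ε / 2 * ‖x - z‖)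
    {x y : X} (hx : x ∈ ball x₀ ρ) (hy : y ∈ ball x₀ ρ) {t : ℝ} (ht : t ∈ Set.Ioo (0 : ℝ) 1) :
    f (t • x + (1 - t) • y) ≤ t * f x + (1 - t) * f y + ε * t * (1 - t) * ‖x - y‖ := by
  have ht0 : 0 < t := ht.1
  have ht1 : 0 < 1 - t := sub_pos.2 ht.2
  set z := t • x + (1 - t) • y with hzdef
  have hz : z ∈ ball x₀ ρ := convex_ball x₀ ρ hx hy ht0.le ht1.le (by ring)
  have hnhds : ∀ u ∈ ball x₀ ρ, ball x₀ ρ ∈ 𝓝 u := fun u hu => isOpen_ball.mem_nhds hu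
  have htr : ∀ u, Tendsto (fun z' => u + (z' - z)) (𝓝 z) (𝓝 u) := fun u => by
    have : Continuous fun z' => u + (z' - z) := by fun_prop
    simpa using this.tendsto z
  have hlim : ∀ u ∈ ball x₀ ρ, Tendsto (fun z' => f (u + (z' - z))) (𝓝 z) (𝓝 (f u)) :=
    fun u hu => (hf.continuousAt (hnhds u hu)).tendsto.comp (htr u)
  have hfz : Tendsto f (𝓝 z) (𝓝 (f z)) := hf.continuousAt (hnhds z hz)
  by_contra! hlt
  have hev := (((tendsto_const_nhds.mul (hlim x hx)).add
    (tendsto_const_nhds.mul (hlim y hy))).add tendsto_const_nhds).eventually_lt hfz hlt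
  have hball : ∀ᶠ z' in 𝓝 z, z' ∈ ball x₀ ρ := hnhds z hz
  obtain ⟨z', hdiff, hlt', hz', hx', hy'⟩ :=
    ((mem_closure_iff_frequently.1 (hdense hz)).and_eventually
      (hev.and (hball.and (((htr x).eventually (hnhds x hx)).and
        ((htr y).eventually (hnhds y hy)))))).exists
  have hdiff : DifferentiableAt ℝ f z' := hdiff
  have ex : x + (z' - z) - z' = (1 - t) • (x - y) := by rw [hzdef]; module
  have ey : y + (z' - z) - z' = (-t) • (x - y) := by rw [hzdef]; module
  have h1 := H z' hz' hdiff _ hx'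
  have h2 := H z' hz' hdiff _ hy'
  rw [ex, map_smul, norm_smul, Real.norm_of_nonneg ht1.le, smul_eq_mul] at h1
  rw [ey, map_smul, norm_smul, norm_neg, Real.norm_of_nonneg ht0.le, smul_eq_mul] at h2
  have h1' := mul_le_mul_of_nonneg_left h1 ht0.le
  have h2' := mul_le_mul_of_nonneg_left h2 ht1.le
  linarith

theorem ClarkeSuperRegularAt.approxConvexAt [CompleteSpace E] [FiniteDimensional ℝ X] {K : NNReal}
    {V : Set X} (h : ClarkeSuperRegularAt Ω ω₀) (hV : V ∈ 𝓝 (L ω₀).1) (hf : LipschitzOnWith K f V)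
    (h0 : f (L ω₀).1 = (L ω₀).2) (hΩ : ∀ᶠ ω in 𝓝 ω₀, ω ∈ Ω ↔ f (L ω).1 ≤ (L ω).2) :
    ApproxConvexAt f (L ω₀).1 := by
  intro ε hε
  obtain ⟨r, hr, hrV⟩ := Metric.mem_nhds_iff.1 hV
  obtain ⟨ρ, H, hρ⟩ := ((h.exists_fderiv_sub_le hV hf h0 hΩ (half_pos hε)).and
    (Ioo_mem_nhdsGT hr)).exists
  have hf' : LipschitzOnWith K f (ball (L ω₀).1 ρ) :=
    hf.mono ((ball_subset_ball hρ.2.le).trans hrV)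
  have hsub : closedBall (L ω₀).1 (ρ / 2) ⊆ ball (L ω₀).1 ρ :=
    closedBall_subset_ball (half_lt_self hρ.1)
  exact ⟨ρ / 2, half_pos hρ.1, fun x hx y hy t ht => le_of_fderiv_sub_le hf'.continuousOn
    (hf'.subset_closure_differentiableAt isOpen_ball) H (hsub hx) (hsub hy) ht⟩

end Epigraph

/-! ### The equivalence -/

theorem mainTheorem3 (n : ℕ) (Ω : Set (EuclideanSpace ℝ (Fin (n + 1))))
    (ω₀ : EuclideanSpace ℝ (Fin (n + 1)))
    (hΩ : EpiLipschitzAt Ω ω₀) (hω₀ : ω₀ ∈ frontier Ω) :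
    List.TFAE
      [ClarkeSuperRegularAt Ω ω₀,
       SubsmoothAt Ω ω₀,
       ∀ (L : EuclideanSpace ℝ (Fin (n + 1)) ≃L[ℝ] EuclideanSpace ℝ (Fin n) × ℝ)
         (f : EuclideanSpace ℝ (Fin n) → ℝ),
         IsLipschitzRepresentation Ω ω₀ L f → ApproxConvexAt f (L ω₀).1,
       ∃ (L : EuclideanSpace ℝ (Fin (n + 1)) ≃L[ℝ] EuclideanSpace ℝ (Fin n) × ℝ)
         (f : EuclideanSpace ℝ (Fin n) → ℝ),
         IsLipschitzRepresentation Ω ω₀ L f ∧ ApproxConvexAt f (L ω₀).1] := by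
  obtain ⟨hmem, L, f, ⟨K, V, hV, hf⟩, U, hU, hUΩ⟩ := hΩ
  have hcl : LocallyClosedAt Ω ω₀ :=
    locallyClosedAt_of_epigraph hV hf.continuousOn (mem_of_superset hU hUΩ)
  tfae_have 1 → 2 := fun h => h.subsmoothAt
  tfae_have 2 → 1 := fun h => h.clarkeSuperRegularAt hcl
  tfae_have 1 → 3 := by
    rintro h L' f' ⟨⟨K', V', hV', hf'⟩, U', hU', hUΩ'⟩
    have hev := mem_of_superset hU' hUΩ'
    exact h.approxConvexAt hV' hf' (apply_fst_eq_snd_of_mem_frontier hω₀ hmem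
      (hf'.continuousOn.continuousAt hV') hev) hev
  tfae_have 3 → 4 := fun h =>
    have hrep : IsLipschitzRepresentation Ω ω₀ L f := ⟨⟨K, V, hV, hf⟩, U, hU, hUΩ⟩
    ⟨L, f, hrep, h L f hrep⟩
  tfae_have 4 → 1 := by
    rintro ⟨L', f', ⟨-, U', hU', hUΩ'⟩, hac⟩
    exact hac.clarkeSuperRegularAt hmem hcl (mem_of_superset hU' hUΩ')
  tfae_finish
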